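/- Let $(X,d,\mu)$ be a locally compact metric measure space, $\mu$ a Radon measure with full support, such that all balls $B(x,r)$ have compact closure and $\mu$ is Ahlfors $d_H$-regular: for some $c_1,c_2,d_H>0$, $c_1r^{d_H}\le\mu(B(x,r))\le c_2r^{d_H}$ for all $x\in X$ and all $r\ge 0$. Let $(\mathcal E,\mathcal F)$ be a regular, strongly local Dirichlet form on $L^2(X,\mu)$ with heat semigroup $(P_t)_{t>0}$ and generator $L$. Assume that $P_t$ has a continuous heat kernel $p_t(x,y)$ such that, for some $d_W\ge 2$ and $c_3,c_4,c_5,c_6>0$, and for every $t>0$ and $\mu\times\mu$-a.e. $(x,y)$, $$c_5t^{-d_H/d_W}\exp\Bigl(-c_6\bigl(\tfrac{d(x,y)^{d_W}}{t}\bigr)^{\frac1{d_W-1}}\Bigr)\le p_t(x,y)\le c_3t^{-d_H/d_W}\exp\Bigl(-c_4\bigl(\tfrac{d(x,y)^{d_W}}{t}\bigr)^{\frac1{d_W-1}}\Bigr).$$ Let $0<\delta<1$, and for $t>0$ let $\eta_t^{(\delta)}$ be the nonnegative continuous function on $(0,\infty)$ with $\int_0^\infty\eta^{(\delta)}_t(s)e^{-s\lambda}\,ds=e^{-t\lambda^\delta}$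 for all $\lambda>0$. Let $p_t^{(\delta)}(x,y)=\int_0^\infty\eta_t^{(\delta)}(s)\,p_s(x,y)\,ds$ be the heat kernel of the subordinated semigroup $P^{(\delta)}_t=\int_0^\infty \eta^{(\delta)}_t(s)P_s\,ds$ associated with the fractional Laplacian $(-L)^\delta$. For $1\le p<\infty$ and $\alpha\ge0$ put $$\|f\|_{p,\alpha}=\sup_{t>0}t^{-\alpha}\Bigl(\int_X\int_X|f(x)-f(y)|^p\,p_t^{(\delta)}(x,y)\,d\mu(x)\,d\mu(y)\Bigr)^{1/p},\qquad \mathbf B^{p,\alpha}(X)=\{f\in L^p(X,\mu):\|f\|_{p,\alpha}<\infty\}.$$ If $1\le p<\infty$ and $\alpha>1/p$, then $\mathbf B^{p,\alpha}(X)=\{0\}$. -/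

import Mathlib

open MeasureTheory Set Filter Topology
open scoped ENNReal

/-- Ahlfors `dH`-regularity: `c₁ r ^ dH ≤ μ (B(x,r)) ≤ c₂ r ^ dH` for all `x` and all `r ≥ 0`. -/
def AhlforsRegular {X : Type*} [MetricSpace X] [MeasurableSpace X] (μ : Measure X) (dH : ℝ) :
    Prop :=
  ∃ c₁ c₂ : ℝ, 0 < c₁ ∧ 0 < c₂ ∧ ∀ (x : X) (r : ℝ), 0 ≤ r →
    ENNReal.ofReal (c₁ * r ^ dH) ≤ μ (Metric.ball x r) ∧
    μ (Metric.ball x r) ≤ ENNReal.ofReal (c₂ * r ^ dH)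

/-- A Dirichlet form on `L²(X, μ)`: a densely defined, closed, symmetric, nonnegative and Markovian
bilinear form. -/
structure DirichletForm {X : Type*} [MeasurableSpace X] (μ : Measure X) where
  /-- the domain `𝓕` -/
  dom : Submodule ℝ (Lp ℝ 2 μ)
  /-- the form `𝓔 : 𝓕 × 𝓕 → ℝ` -/
  form : LinearMap.BilinForm ℝ dom
  dense_dom : Dense (dom : Set (Lp ℝ 2 μ))
  symm : ∀ f g : dom, form f g = form g f
  nonneg : ∀ f : dom, 0 ≤ form f f
  /-- closedness: `𝓕` is complete for the norm `(𝓔(f,f) + ‖f‖²)^(1/2)` -/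
  closed : ∀ u : ℕ → dom,
    (∀ ε : ℝ, 0 < ε → ∃ N : ℕ, ∀ m n : ℕ, N ≤ m → N ≤ n →
      form (u m - u n) (u m - u n) + ‖((u m - u n : dom) : Lp ℝ 2 μ)‖ ^ 2 < ε) →
    ∃ v : dom, Tendsto
      (fun n => form (u n - v) (u n - v) + ‖((u n - v : dom) : Lp ℝ 2 μ)‖ ^ 2) atTop (𝓝 0)
  /-- the unit contraction `(0 ∨ f) ∧ 1` operates on the form -/
  markov : ∀ f : dom, ∃ g : dom,
    (((g : Lp ℝ 2 μ) : X → ℝ) =ᵐ[μ] fun x => min (max 0 ((f : Lp ℝ 2 μ) x)) 1) ∧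
    form g g ≤ form f f

namespace DirichletForm

variable {X : Type*} [MetricSpace X] [MeasurableSpace X] {μ : Measure X}

/-- The square of the norm `‖f‖_{𝓔₁} = (‖f‖² + 𝓔(f,f))^(1/2)` on the domain. -/
noncomputable def energyOne (E : DirichletForm μ) (f : E.dom) : ℝ :=
  ‖(f : Lp ℝ 2 μ)‖ ^ 2 + E.form f f

/-- Regularity: there is a core, i.e. a set of functions in `C_c(X) ∩ 𝓕` that is dense in `C_c(X)`
for the supremum norm and dense in `𝓕` for the norm `‖·‖_{𝓔₁}`. -/
def IsRegular (E : DirichletForm μ) : Prop :=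
  ∃ core : Set (X → ℝ),
    (∀ ψ ∈ core, Continuous ψ ∧ HasCompactSupport ψ ∧
      ∃ g : E.dom, ((g : Lp ℝ 2 μ) : X → ℝ) =ᵐ[μ] ψ) ∧
    (∀ φ : X → ℝ, Continuous φ → HasCompactSupport φ → ∀ ε : ℝ, 0 < ε →
      ∃ ψ ∈ core, ∀ x, |φ x - ψ x| < ε) ∧
    (∀ f : E.dom, ∀ ε : ℝ, 0 < ε → ∃ ψ ∈ core, ∃ g : E.dom,
      (((g : Lp ℝ 2 μ) : X → ℝ) =ᵐ[μ] ψ) ∧ E.energyOne (f - g) < ε)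

/-- The support of an almost everywhere defined function: the complement of the largest open set
on which it vanishes almost everywhere. -/
def aeSupport (μ : Measure X) (f : X → ℝ) : Set X :=
  {x | ∀ U ∈ 𝓝 x, μ {y ∈ U | f y ≠ 0} ≠ 0}

/-- Strong locality: `𝓔(f,g) = 0` whenever `f, g ∈ 𝓕` have compact supports and `f` is constant in
a neighborhood of the support of `g`. -/
def IsStronglyLocal (E : DirichletForm μ) : Prop :=
  ∀ f g : E.dom,
    IsCompact (aeSupport μ ((f : Lp ℝ 2 μ) : X → ℝ)) →
    IsCompact (aeSupport μ ((g : Lp ℝ 2 μ) : X → ℝ)) →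
    (∃ U : Set X, IsOpen U ∧ aeSupport μ ((g : Lp ℝ 2 μ) : X → ℝ) ⊆ U ∧
      ∃ c : ℝ, ∀ᵐ x ∂μ, x ∈ U → (f : Lp ℝ 2 μ) x = c) →
    E.form f g = 0

/-- `P = (P_t)_{t > 0}` is the heat semigroup of the Dirichlet form `𝓔`: the strongly continuous
contraction semigroup on `L²(X, μ)` whose infinitesimal generator is the operator `L` associated
with `𝓔`, that is `f ∈ dom L` and `L f = g` if and only if `f ∈ 𝓕` and `𝓔(f,h) = -⟨g,h⟩` for all
`h ∈ 𝓕`. -/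
structure IsHeatSemigroup (E : DirichletForm μ) (P : ℝ → Lp ℝ 2 μ →L[ℝ] Lp ℝ 2 μ) : Prop where
  semigroup : ∀ s t : ℝ, 0 < s → 0 < t → P (s + t) = (P s).comp (P t)
  contraction : ∀ t : ℝ, 0 < t → ‖P t‖ ≤ 1
  strongly_continuous : ∀ f : Lp ℝ 2 μ, Tendsto (fun t => P t f) (𝓝[>] 0) (𝓝 f)
  generator : ∀ f g : Lp ℝ 2 μ,
    Tendsto (fun t : ℝ => t⁻¹ • (P t f - f)) (𝓝[>] 0) (𝓝 g) ↔
      ∃ hf : f ∈ E.dom, ∀ h : E.dom, E.form ⟨f, hf⟩ h = -inner ℝ g (h : Lp ℝ 2 μ)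

end DirichletForm

/-- `p_t(x,y)`, `t > 0`, is a continuous heat kernel of the semigroup `P`: each `p_t` is continuous
on `X × X` and `P_t f (x) = ∫ p_t(x,y) f(y) dμ(y)` for every `f ∈ L²(X, μ)` and `μ`-a.e. `x`. -/
structure IsContinuousHeatKernel {X : Type*} [MetricSpace X] [MeasurableSpace X] {μ : Measure X}
    (P : ℝ → Lp ℝ 2 μ →L[ℝ] Lp ℝ 2 μ) (p : ℝ → X → X → ℝ) : Prop where
  continuous : ∀ t : ℝ, 0 < t → Continuous fun z : X × X => p t z.1 z.2
  represents : ∀ t : ℝ, 0 < t → ∀ f : Lp ℝ 2 μ, ∀ᵐ x ∂μ,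
    Integrable (fun y => p t x y * f y) μ ∧ P t f x = ∫ y, p t x y * f y ∂μ

/-- Two-sided sub-Gaussian bounds
`c₅ t^(-dH/dW) exp(-c₆ (d(x,y)^dW/t)^(1/(dW-1))) ≤ p_t(x,y)
  ≤ c₃ t^(-dH/dW) exp(-c₄ (d(x,y)^dW/t)^(1/(dW-1)))`
for every `t > 0` and `μ × μ`-a.e. `(x,y)`. -/
def SubGaussianBounds {X : Type*} [MetricSpace X] [MeasurableSpace X] (μ : Measure X)
    (dH dW : ℝ) (p : ℝ → X → X → ℝ) : Prop :=
  ∃ c₃ c₄ c₅ c₆ : ℝ, 0 < c₃ ∧ 0 < c₄ ∧ 0 < c₅ ∧ 0 < c₆ ∧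
    ∀ t : ℝ, 0 < t → ∀ᵐ z : X × X ∂(μ.prod μ),
      c₅ * t ^ (-dH / dW) *
          Real.exp (-c₆ * (dist z.1 z.2 ^ dW / t) ^ (1 / (dW - 1))) ≤ p t z.1 z.2 ∧
      p t z.1 z.2 ≤ c₃ * t ^ (-dH / dW) *
          Real.exp (-c₄ * (dist z.1 z.2 ^ dW / t) ^ (1 / (dW - 1)))

/-- `η_t(s)` (`t, s > 0`) is the density of the `δ`-stable subordinator: for each `t > 0`, the
nonnegative continuous function on `(0,∞)` with
`∫₀^∞ η_t(s) e^(-sl) ds = e^(-t l^δ)` for every `l > 0`. -/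
structure IsStableSubordinatorDensity (δ : ℝ) (η : ℝ → ℝ → ℝ) : Prop where
  continuousOn : ∀ t : ℝ, 0 < t → ContinuousOn (η t) (Ioi 0)
  nonneg : ∀ t s : ℝ, 0 < t → 0 < s → 0 ≤ η t s
  laplace : ∀ t l : ℝ, 0 < t → 0 < l →
    IntegrableOn (fun s => η t s * Real.exp (-s * l)) (Ioi 0) ∧
    ∫ s in Ioi (0 : ℝ), η t s * Real.exp (-s * l) = Real.exp (-t * l ^ δ)

/-- The heat kernel `p_t^{(δ)}(x,y) = ∫₀^∞ η_t(s) p_s(x,y) ds` of the subordinated semigroup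
`P_t^{(δ)} = ∫₀^∞ η_t(s) P_s ds` generated by the fractional Laplacian `(-L)^δ`, as a function
with values in `[0,∞]`. -/
noncomputable def subordinatedKernel {X : Type*} (η : ℝ → ℝ → ℝ) (p : ℝ → X → X → ℝ)
    (t : ℝ) (x y : X) : ℝ≥0∞ :=
  ∫⁻ s in Ioi (0 : ℝ), ENNReal.ofReal (η t s * p s x y)

/-- The Besov seminorm of exponents `q` (integrability) and `α`, for a kernel `k_t(x,y)`:
`sup_{t>0} t^(-α) (∫∫ |f(x) - f(y)|^q k_t(x,y) dμ(x) dμ(y))^(1/q)`. -/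
noncomputable def besovSeminorm {X : Type*} [MeasurableSpace X] (μ : Measure X)
    (k : ℝ → X → X → ℝ≥0∞) (q α : ℝ) (f : X → ℝ) : ℝ≥0∞ :=
  ⨆ (t : ℝ) (_ : 0 < t), ENNReal.ofReal (t ^ (-α)) *
    (∫⁻ y, ∫⁻ x, ENNReal.ofReal (|f x - f y| ^ q) * k t x y ∂μ ∂μ) ^ (1 / q)

/-- The heat semigroup based Besov class: all `f ∈ L^q(X, μ)` with finite Besov seminorm. -/
def besovClass {X : Type*} [MeasurableSpace X] (μ : Measure X)
    (k : ℝ → X → X → ℝ≥0∞) (q α : ℝ) : Set (Lp ℝ (ENNReal.ofReal q) μ) :=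
  {f | besovSeminorm μ k q α f < ∞}

/-! The subordinated semigroup jumps: at bounded distance `p_t^{(δ)}(x,y)` is at least `c t` for
small `t`. Hence `c t` times the oscillation integral of `f` over a ball is at most `N ^ q * t ^ (α
q)`, with `N` the seminorm; since `α q > 1`, dividing by `t` and letting `t → 0` makes `f` a.e.
constant on every ball. Ahlfors regularity gives infinite total mass, so the constant is `0`.

The linear bound needs no asymptotics of `η_t`, only its Laplace transform. The combination of
exponentials `expBump` lies below a multiple of the sub-Gaussian lower bound
(`expBump_le_subGaussian`), while its integral against `η_t` vanishes at `t = 0` with positive slope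
(`exists_linear_lower_bound`). -/

/-! ### An exponential test function -/

/-- Increments of the concave power `M ↦ M ^ δ` become small. -/
lemma exists_rpow_increment_lt {δ : ℝ} (hδ0 : 0 < δ) (hδ1 : δ < 1) {ε : ℝ} (hε : 0 < ε) :
    ∃ M : ℝ, 1 < M ∧ (M + 1) ^ δ - M ^ δ < ε := by
  have h := tendsto_rpow_neg_atTop (y := 1 - δ) (by linarith)
  obtain ⟨M, hM, hM1⟩ := ((h.eventually (gt_mem_nhds hε)).and (eventually_gt_atTop 1)).exists
  have hM0 : 0 < M := by linarith
  refine ⟨M, hM1, lt_of_le_of_lt ?_ hM⟩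
  -- Bernoulli bounds the increment by `δ * M ^ (δ - 1)`, which tends to `0`.
  have hB : (1 + 1 / M) ^ δ ≤ 1 + δ * (1 / M) :=
    rpow_one_add_le_one_add_mul_self (by have : 0 < 1 / M := by positivity
                                         linarith) hδ0.le hδ1.le
  have h1 : (M + 1) ^ δ = M ^ δ * (1 + 1 / M) ^ δ := by
    rw [← Real.mul_rpow hM0.le (by positivity)]
    congr 1
    field_simp
  have h2 : M ^ (-(1 - δ)) = M ^ δ * (1 / M) := by
    rw [show -(1 - δ) = δ - 1 by ring, Real.rpow_sub_one hM0.ne']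
    ring
  have h3 : 0 < M ^ δ * (1 / M) := by positivity
  have h4 := mul_le_mul_of_nonneg_left hB (Real.rpow_nonneg hM0.le δ)
  rw [h1, h2]
  nlinarith

/-- A combination of exponentials that is nonpositive near `0`. -/
noncomputable def expBump (M s : ℝ) : ℝ :=
  Real.exp (-s * 1) - Real.exp (-s * 2) - 2 * Real.exp (-s * M) + 2 * Real.exp (-s * (M + 1))

/-- For `s > 0` only the last factor can change sign, at `s = log 2 / (M - 1)`; the coefficient `2`
is what makes it negative near `0`. -/
lemma expBump_eq (M s : ℝ) :
    expBump M s =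
      Real.exp (-s) * (1 - Real.exp (-s)) * (1 - 2 * Real.exp (-(s * (M - 1)))) := by
  have h2 : Real.exp (-s * 2) = Real.exp (-s) * Real.exp (-s) := by
    rw [← Real.exp_add]; ring_nf
  have h3 : Real.exp (-s * M) = Real.exp (-s) * Real.exp (-(s * (M - 1))) := by
    rw [← Real.exp_add]; ring_nf
  have h4 : Real.exp (-s * (M + 1)) =
      Real.exp (-s) * Real.exp (-s) * Real.exp (-(s * (M - 1))) := by
    rw [← Real.exp_add, ← Real.exp_add]; ring_nf
  rw [expBump, h2, h3, h4, mul_one]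
  ring

lemma expBump_nonpos {M s : ℝ} (hM : 1 < M) (hs : 0 < s) (h : s ≤ Real.log 2 / (M - 1)) :
    expBump M s ≤ 0 := by
  have h1 : Real.exp (-s) ≤ 1 := Real.exp_le_one_iff.2 (by linarith)
  have h2 : 1 / 2 ≤ Real.exp (-(s * (M - 1))) := by
    rw [le_div_iff₀ (by linarith)] at h
    rw [Real.exp_neg, one_div]
    refine inv_anti₀ (Real.exp_pos _) ?_
    calc Real.exp (s * (M - 1)) ≤ Real.exp (Real.log 2) := Real.exp_le_exp.2 h
      _ = 2 := Real.exp_log (by norm_num)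
  rw [expBump_eq]
  exact mul_nonpos_of_nonneg_of_nonpos
    (mul_nonneg (Real.exp_pos _).le (by linarith)) (by linarith)

lemma expBump_le_exp_neg {M s : ℝ} (hs : 0 < s) : expBump M s ≤ Real.exp (-s) := by
  have h1 : Real.exp (-s) ≤ 1 := Real.exp_le_one_iff.2 (by linarith)
  have h0 := Real.exp_pos (-s)
  have h2 := Real.exp_pos (-(s * (M - 1)))
  rw [expBump_eq, mul_assoc]
  refine mul_le_of_le_one_right h0.le ?_
  nlinarith [mul_nonneg (sub_nonneg.2 h1) h2.le]

/-- A sub-Gaussian lower bound dominates a multiple of `expBump`. -/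
lemma expBump_le_subGaussian {M a b c R : ℝ} (hM : 1 < M) (ha : 0 < a) (hb : 0 ≤ b)
    (hc : 0 ≤ c) (hR : 0 ≤ R) :
    ∃ κ : ℝ, 0 < κ ∧ ∀ s D : ℝ, 0 < s → 0 ≤ D → D ≤ R →
      κ * expBump M s ≤ s ^ (-a) * Real.exp (-c * (D / s) ^ b) := by
  set s₀ := Real.log 2 / (M - 1) with hs₀
  have hs₀pos : 0 < s₀ := div_pos (Real.log_pos (by norm_num)) (by linarith)
  -- Only `s ≥ s₀` matters: there the stretched exponential is smallest at `D = R`, `s = s₀`, and `s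
  -- ^ (-a) ≥ a ^ (-a) * e ^ (-s)`.
  refine ⟨(a ^ a)⁻¹ * Real.exp (-c * (R / s₀) ^ b), by positivity, fun s D hs hD hDR => ?_⟩
  rcases le_total s s₀ with h | h
  · exact (mul_nonpos_of_nonneg_of_nonpos (by positivity) (expBump_nonpos hM hs h)).trans
      (by positivity)
  · have h1 : Real.exp (-c * (R / s₀) ^ b) ≤ Real.exp (-c * (D / s) ^ b) := by
      refine Real.exp_le_exp.2 ?_
      rw [neg_mul, neg_mul, neg_le_neg_iff]
      gcongr
    have h2 : (a ^ a)⁻¹ * Real.exp (-s) ≤ s ^ (-a) := by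
      rw [Real.rpow_neg hs.le, Real.exp_neg, ← mul_inv]
      refine inv_anti₀ (Real.rpow_pos_of_pos hs a) ?_
      have h3 : s ≤ a * Real.exp (s / a) := by
        have := Real.add_one_le_exp (s / a)
        calc s = a * (s / a) := by field_simp
          _ ≤ _ := by gcongr; linarith
      calc s ^ a ≤ (a * Real.exp (s / a)) ^ a := by gcongr
        _ = a ^ a * Real.exp s := by
          rw [Real.mul_rpow ha.le (Real.exp_pos _).le, ← Real.exp_mul]
          congr 2
          field_simp
    calc (a ^ a)⁻¹ * Real.exp (-c * (R / s₀) ^ b) * expBump M s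
        ≤ (a ^ a)⁻¹ * Real.exp (-c * (R / s₀) ^ b) * Real.exp (-s) := by
          gcongr
          exact expBump_le_exp_neg hs
      _ = ((a ^ a)⁻¹ * Real.exp (-s)) * Real.exp (-c * (R / s₀) ^ b) := by ring
      _ ≤ _ := by gcongr

/-! ### Small-time mass of the stable subordinator -/

namespace IsStableSubordinatorDensity

variable {δ : ℝ} {η : ℝ → ℝ → ℝ}

lemma integral_expBump (hη : IsStableSubordinatorDensity δ η) {M t : ℝ} (hM : 1 < M)
    (ht : 0 < t) :
    IntegrableOn (fun s => η t s * expBump M s) (Ioi 0) ∧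
      ∫ s in Ioi (0 : ℝ), η t s * expBump M s =
        Real.exp (-t * 1 ^ δ) - Real.exp (-t * 2 ^ δ) - 2 * Real.exp (-t * M ^ δ)
          + 2 * Real.exp (-t * (M + 1) ^ δ) := by
  obtain ⟨i1, e1⟩ := hη.laplace t 1 ht one_pos
  obtain ⟨i2, e2⟩ := hη.laplace t 2 ht two_pos
  obtain ⟨i3, e3⟩ := hη.laplace t M ht (by linarith)
  obtain ⟨i4, e4⟩ := hη.laplace t (M + 1) ht (by linarith)
  have h : (fun s => η t s * expBump M s) = fun s =>
      η t s * Real.exp (-s * 1) - η t s * Real.exp (-s * 2)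
        - 2 * (η t s * Real.exp (-s * M)) + 2 * (η t s * Real.exp (-s * (M + 1))) := by
    funext s
    rw [expBump]
    ring
  rw [h]
  have i12 := i1.sub i2
  have i3' := i3.const_mul 2
  have i4' := i4.const_mul 2
  refine ⟨(i12.sub i3').add i4', ?_⟩
  have A := integral_add (i12.sub i3') i4'
  have B := integral_sub i12 i3'
  have C := integral_sub i1 i2
  simp only [Pi.sub_apply] at A B
  rw [A, B, C, integral_const_mul, integral_const_mul, e1, e2, e3, e4]

/-- The mass that `η_t` puts away from `0` is at least of order `t`. -/
lemma exists_linear_lower_bound (hη : IsStableSubordinatorDensity δ η) (hδ0 : 0 < δ)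
    (hδ1 : δ < 1) :
    ∃ M c : ℝ, 1 < M ∧ 0 < c ∧ ∀ᶠ t in 𝓝[>] (0 : ℝ),
      c * t ≤ ∫ s in Ioi (0 : ℝ), η t s * expBump M s := by
  have h2 : 1 < (2 : ℝ) ^ δ := Real.one_lt_rpow (by norm_num) hδ0
  -- The slope at `t = 0` is `(2 ^ δ - 1) - 2 * ((M + 1) ^ δ - M ^ δ)`, positive for this choice of
  -- `M`.
  obtain ⟨M, hM, hMδ⟩ := exists_rpow_increment_lt hδ0 hδ1 (ε := ((2 : ℝ) ^ δ - 1) / 2) (by linarith)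
  have hd : ∀ l : ℝ, HasDerivAt (fun t : ℝ => Real.exp (-t * l)) (-l) 0 := fun l => by
    have := (((hasDerivAt_id (0 : ℝ)).neg).mul_const l).exp
    simpa using this
  have hF := (((hd (1 ^ δ)).sub (hd (2 ^ δ))).sub ((hd (M ^ δ)).const_mul 2)).add
    ((hd ((M + 1) ^ δ)).const_mul 2)
  set Λ := -(1 : ℝ) ^ δ - -2 ^ δ - 2 * -M ^ δ + 2 * -(M + 1) ^ δ with hΛ
  have hΛ0 : 0 < Λ := by
    rw [hΛ, Real.one_rpow]
    linarith
  refine ⟨M, Λ / 2, hM, by positivity, ?_⟩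
  -- The value at `0` is `1 - 1 - 2 + 2 = 0`, so the difference quotient is the integral divided by
  -- `t`.
  have hev := hF.tendsto_slope_zero_right.eventually (lt_mem_nhds (half_lt_self hΛ0))
  filter_upwards [hev, self_mem_nhdsWithin] with t ht ht0
  have ht0 : 0 < t := ht0
  rw [(hη.integral_expBump hM ht0).2]
  simp only [Pi.add_apply, Pi.sub_apply, zero_add, neg_zero, zero_mul, Real.exp_zero,
    smul_eq_mul] at ht
  rw [inv_mul_eq_div, lt_div_iff₀ ht0] at ht
  linarith

end IsStableSubordinatorDensity

/-! ### Jump-type lower bound and vanishing oscillation -/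

/-- The lower sub-Gaussian bound gives `p_t^{(δ)}(x,y) ≥ c t` for small `t`, uniformly in `x, y`
at bounded distance. -/
lemma exists_linear_le_subordinatedKernel {X : Type*} [MetricSpace X] {dH dW c₅ c₆ δ : ℝ}
    (hdH : 0 < dH) (hdW : 2 ≤ dW) (hc₅ : 0 < c₅) (hc₆ : 0 < c₆) {p : ℝ → X → X → ℝ}
    (hp : ∀ t : ℝ, 0 < t → ∀ x y, c₅ * t ^ (-dH / dW) *
      Real.exp (-c₆ * (dist x y ^ dW / t) ^ (1 / (dW - 1))) ≤ p t x y)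
    (hδ0 : 0 < δ) (hδ1 : δ < 1) {η : ℝ → ℝ → ℝ} (hη : IsStableSubordinatorDensity δ η)
    {R : ℝ} (hR : 0 ≤ R) :
    ∃ c : ℝ, 0 < c ∧ ∀ᶠ t in 𝓝[>] (0 : ℝ), ∀ x y, dist x y ≤ R →
      ENNReal.ofReal (c * t) ≤ subordinatedKernel η p t x y := by
  obtain ⟨M, c, hM, hc, hev⟩ := hη.exists_linear_lower_bound hδ0 hδ1
  have hdW0 : 0 < dW := by linarith
  obtain ⟨κ, hκ, hle⟩ := expBump_le_subGaussian (a := dH / dW) (b := 1 / (dW - 1)) (c := c₆)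
    (R := R ^ dW) hM (by positivity) (one_div_nonneg.2 (by linarith)) hc₆.le (by positivity)
  refine ⟨c₅ * κ * c, by positivity, ?_⟩
  filter_upwards [hev, self_mem_nhdsWithin] with t ht ht0 x y hxy
  have ht0 : 0 < t := ht0
  calc ENNReal.ofReal (c₅ * κ * c * t)
      ≤ ENNReal.ofReal (∫ s in Ioi (0 : ℝ), c₅ * κ * (η t s * expBump M s)) := by
        refine ENNReal.ofReal_le_ofReal ?_
        rw [integral_const_mul, mul_assoc]
        gcongr
    _ ≤ ∫⁻ s in Ioi (0 : ℝ), ENNReal.ofReal (c₅ * κ * (η t s * expBump M s)) := by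
        -- The integrand changes sign; discarding its negative part only increases the integral.
        rw [integral_eq_lintegral_pos_part_sub_lintegral_neg_part
          ((hη.integral_expBump hM ht0).1.const_mul _)]
        refine (ENNReal.ofReal_le_ofReal (sub_le_self _ ENNReal.toReal_nonneg)).trans ?_
        exact ENNReal.ofReal_toReal_le
    _ ≤ _ := by
        refine setLIntegral_mono' measurableSet_Ioi fun s hs => ENNReal.ofReal_le_ofReal ?_
        have hs : 0 < s := hs
        have h1 := hle s (dist x y ^ dW) hs (by positivity) (by gcongr)
        have h2 := hp s hs x y
        rw [neg_div, mul_assoc] at h2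
        calc c₅ * κ * (η t s * expBump M s) = η t s * (c₅ * (κ * expBump M s)) := by ring
          _ ≤ η t s * p s x y :=
            mul_le_mul_of_nonneg_left
              ((mul_le_mul_of_nonneg_left h1 hc₅.le).trans h2) (hη.nonneg t s ht0 hs)

/-- For a kernel that is at least of order `t` on bounded sets, a function of finite Besov seminorm
with `α > 1 / q` has no oscillation. -/
lemma setLIntegral_eq_zero_of_besovSeminorm_lt_top {X : Type*} [MetricSpace X]
    [MeasurableSpace X] [BorelSpace X] {μ : Measure X} {k : ℝ → X → X → ℝ≥0∞} {q α : ℝ}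
    (hq : 0 < q) (hα : 1 / q < α) {f : X → ℝ} (hf : besovSeminorm μ k q α f < ∞) {s : Set X}
    (hs : MeasurableSet s) {c : ℝ} (hc : 0 < c)
    (hk : ∀ᶠ t in 𝓝[>] (0 : ℝ), ∀ x ∈ s, ∀ y ∈ s, ENNReal.ofReal (c * t) ≤ k t x y) :
    ∫⁻ y in s, ∫⁻ x in s, ENNReal.ofReal (|f x - f y| ^ q) ∂μ ∂μ = 0 := by
  set N := besovSeminorm μ k q α f with hN
  set J := ∫⁻ y in s, ∫⁻ x in s, ENNReal.ofReal (|f x - f y| ^ q) ∂μ ∂μ with hJ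
  have hpow : 0 < α * q - 1 := by
    rw [div_lt_iff₀ hq] at hα
    linarith
  have hbound : ∀ᶠ t in 𝓝[>] (0 : ℝ),
      J ≤ N ^ q * ENNReal.ofReal (c⁻¹ * t ^ (α * q - 1)) := by
    filter_upwards [hk, self_mem_nhdsWithin] with t hkt ht0
    have ht0 : 0 < t := ht0
    set I := ∫⁻ y, ∫⁻ x, ENNReal.ofReal (|f x - f y| ^ q) * k t x y ∂μ ∂μ with hI
    have h1 : J * ENNReal.ofReal (c * t) ≤ I := by
      calc J * ENNReal.ofReal (c * t)
          = ∫⁻ y in s, ∫⁻ x in s,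
              ENNReal.ofReal (|f x - f y| ^ q) * ENNReal.ofReal (c * t) ∂μ ∂μ := by
            rw [hJ, ← lintegral_mul_const' _ _ ENNReal.ofReal_ne_top]
            simp_rw [lintegral_mul_const' _ _ ENNReal.ofReal_ne_top]
        _ ≤ ∫⁻ y in s, ∫⁻ x in s, ENNReal.ofReal (|f x - f y| ^ q) * k t x y ∂μ ∂μ :=
            setLIntegral_mono' hs fun y hy => setLIntegral_mono' hs fun x hx => by
              gcongr
              exact hkt x hx y hy
        _ ≤ I := (lintegral_mono fun y => setLIntegral_le_lintegral _ _).trans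
            (setLIntegral_le_lintegral _ _)
    have h2 : ENNReal.ofReal (t ^ (-α)) * I ^ (1 / q) ≤ N :=
      le_iSup₂ (f := fun (t : ℝ) (_ : 0 < t) => ENNReal.ofReal (t ^ (-α)) *
        (∫⁻ y, ∫⁻ x, ENNReal.ofReal (|f x - f y| ^ q) * k t x y ∂μ ∂μ) ^ (1 / q)) t ht0
    have h3 : ENNReal.ofReal (t ^ (-(α * q))) * I ≤ N ^ q := by
      have := ENNReal.rpow_le_rpow h2 hq.le
      rwa [ENNReal.mul_rpow_of_nonneg _ _ hq.le, ← ENNReal.rpow_mul, one_div,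
        inv_mul_cancel₀ hq.ne', ENNReal.rpow_one,
        ENNReal.ofReal_rpow_of_nonneg (by positivity) hq.le, ← Real.rpow_mul ht0.le,
        neg_mul] at this
    -- An explicit inverse factor replaces division in `[0,∞]`, so `J` need not be known finite.
    have h4 : ENNReal.ofReal (c * t) * ENNReal.ofReal (t ^ (-(α * q))) *
        ENNReal.ofReal (c⁻¹ * t ^ (α * q - 1)) = 1 := by
      rw [← ENNReal.ofReal_mul (by positivity), ← ENNReal.ofReal_mul (by positivity),
        Real.rpow_neg ht0.le, Real.rpow_sub_one ht0.ne']
      have : t ^ (α * q) ≠ 0 := (Real.rpow_pos_of_pos ht0 _).ne'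
      rw [← ENNReal.ofReal_one]
      congr 1
      field_simp
    calc J = J * (ENNReal.ofReal (c * t) * ENNReal.ofReal (t ^ (-(α * q))) *
        ENNReal.ofReal (c⁻¹ * t ^ (α * q - 1))) := by rw [h4, mul_one]
      _ = ENNReal.ofReal (t ^ (-(α * q))) * (J * ENNReal.ofReal (c * t)) *
        ENNReal.ofReal (c⁻¹ * t ^ (α * q - 1)) := by ring
      _ ≤ _ := by
        gcongr
        exact (by gcongr : _ ≤ ENNReal.ofReal (t ^ (-(α * q))) * I).trans h3
  have hlim : Tendsto (fun t : ℝ => N ^ q * ENNReal.ofReal (c⁻¹ * t ^ (α * q - 1)))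
      (𝓝[>] 0) (𝓝 0) := by
    have h1 : Tendsto (fun t : ℝ => c⁻¹ * t ^ (α * q - 1)) (𝓝[>] 0) (𝓝 0) := by
      have h := ((Real.continuousAt_rpow_const 0 (α * q - 1) (Or.inr hpow.le)).const_mul c⁻¹).tendsto
      simp only [Real.zero_rpow hpow.ne', mul_zero] at h
      exact h.mono_left nhdsWithin_le_nhds
    have h2 := ENNReal.tendsto_ofReal h1
    rw [ENNReal.ofReal_zero] at h2
    simpa using ENNReal.Tendsto.const_mul h2
      (Or.inr (ENNReal.rpow_ne_top_of_nonneg hq.le hf.ne))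
  exact le_antisymm (ge_of_tendsto hlim hbound) zero_le

/-! ### From zero oscillation to zero -/

/-- An almost everywhere inequality between continuous functions holds everywhere. -/
lemma le_of_ae_le_of_isOpenPosMeasure {Y : Type*} [TopologicalSpace Y] [MeasurableSpace Y]
    {ν : Measure Y} [ν.IsOpenPosMeasure] {u v : Y → ℝ} (hu : Continuous u) (hv : Continuous v)
    (h : ∀ᵐ z ∂ν, u z ≤ v z) (z : Y) : u z ≤ v z := by
  have hd : Dense {z | u z ≤ v z} := Measure.dense_of_ae h
  have : closure {z | u z ≤ v z} = univ := hd.closure_eq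
  rw [(isClosed_le hu hv).closure_eq] at this
  exact this.ge (mem_univ z)

lemma AhlforsRegular.measure_univ_eq_top {X : Type*} [MetricSpace X] [MeasurableSpace X]
    [Nonempty X] {μ : Measure X} {dH : ℝ} (hdH : 0 < dH) (h : AhlforsRegular μ dH) :
    μ univ = ∞ := by
  obtain ⟨c₁, c₂, hc₁, -, h⟩ := h
  obtain ⟨x⟩ := ‹Nonempty X›
  have hlim : Tendsto (fun r : ℝ => ENNReal.ofReal (c₁ * r ^ dH)) atTop (𝓝 ∞) :=
    ENNReal.tendsto_ofReal_atTop.comp ((tendsto_rpow_atTop hdH).const_mul_atTop hc₁)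
  refine top_le_iff.1 (le_of_tendsto hlim ?_)
  filter_upwards [eventually_ge_atTop 0] with r hr
  exact (h x r hr).1.trans (measure_mono (subset_univ _))

/-- The iterated form of the conclusion allows a single reference point `y` to be fixed later. -/
lemma ae_eq_on_of_setLIntegral_eq_zero {X : Type*} [MeasurableSpace X] {μ : Measure X} [SFinite μ]
    {f : X → ℝ} (hf : Measurable f) {q : ℝ} {s : Set X} (hq : 0 < q) (hs : MeasurableSet s)
    (h : ∫⁻ y in s, ∫⁻ x in s, ENNReal.ofReal (|f x - f y| ^ q) ∂μ ∂μ = 0) :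
    ∀ᵐ y ∂μ, y ∈ s → ∀ᵐ x ∂μ, x ∈ s → f x = f y := by
  have hm : Measurable fun z : X × X => ENNReal.ofReal (|f z.2 - f z.1| ^ q) := by fun_prop
  rw [lintegral_eq_zero_iff hm.lintegral_prod_right'] at h
  filter_upwards [(ae_restrict_iff' hs).1 h] with y hy hys
  have h2 := hy hys
  rw [Pi.zero_apply, lintegral_eq_zero_iff (by fun_prop)] at h2
  filter_upwards [(ae_restrict_iff' hs).1 h2] with x hx hxs
  have h3 := ENNReal.ofReal_eq_zero.1 (hx hxs)
  have h4 := (Real.rpow_eq_zero (abs_nonneg _) hq.ne').1 (h3.antisymm (by positivity))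
  exact sub_eq_zero.1 (abs_eq_zero.1 h4)

lemma besovSeminorm_eq_zero_of_ae_eq_zero {X : Type*} [MeasurableSpace X] {μ : Measure X}
    (k : ℝ → X → X → ℝ≥0∞) {q : ℝ} (hq : 0 < q) (α : ℝ) {f : X → ℝ} (hf : f =ᵐ[μ] 0) :
    besovSeminorm μ k q α f = 0 := by
  simp only [besovSeminorm, ENNReal.iSup_eq_zero]
  intro t _
  have h : ∫⁻ y, ∫⁻ x, ENNReal.ofReal (|f x - f y| ^ q) * k t x y ∂μ ∂μ = 0 := by
    rw [← lintegral_zero (μ := μ)]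
    refine lintegral_congr_ae ?_
    filter_upwards [hf] with y hy
    rw [← lintegral_zero (μ := μ)]
    refine lintegral_congr_ae ?_
    filter_upwards [hf] with x hx
    simp [hx, hy, Real.zero_rpow hq.ne']
  rw [h, ENNReal.zero_rpow_of_pos (by positivity), mul_zero]

theorem mainTheorem7 {X : Type*} [MetricSpace X] [LocallyCompactSpace X]
    [MeasurableSpace X] [BorelSpace X]
    (μ : Measure X) [μ.Regular] [μ.IsOpenPosMeasure]
    (hballs : ∀ (x : X) (r : ℝ), 0 < r → IsCompact (closure (Metric.ball x r)))
    (dH dW : ℝ) (hdH : 0 < dH) (hdW : 2 ≤ dW)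
    (hAhlfors : AhlforsRegular μ dH)
    (E : DirichletForm μ) (hreg : E.IsRegular) (hloc : E.IsStronglyLocal)
    (P : ℝ → Lp ℝ 2 μ →L[ℝ] Lp ℝ 2 μ) (hP : E.IsHeatSemigroup P)
    (p : ℝ → X → X → ℝ) (hp : IsContinuousHeatKernel P p)
    (hsub : SubGaussianBounds μ dH dW p)
    (δ : ℝ) (hδ0 : 0 < δ) (hδ1 : δ < 1)
    (η : ℝ → ℝ → ℝ) (hη : IsStableSubordinatorDensity δ η)
    (q α : ℝ) (hq : 1 ≤ q) (hα : 1 / q < α) :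
    besovClass μ (subordinatedKernel η p) q α = {0} := by
  have hq0 : 0 < q := by linarith
  refine Subset.antisymm (fun f hf => ?_) ?_
  swap
  · rintro _ rfl
    change besovSeminorm μ _ q α _ < ∞
    rw [besovSeminorm_eq_zero_of_ae_eq_zero _ hq0 α (Lp.coeFn_zero _ _ _)]
    exact ENNReal.zero_lt_top
  have hf : besovSeminorm μ (subordinatedKernel η p) q α f < ∞ := hf
  rw [mem_singleton_iff, Lp.eq_zero_iff_ae_eq_zero]
  rcases isEmpty_or_nonempty X with hX | hX
  · exact Eventually.of_forall fun x => hX.elim x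
  -- Properness makes `X` second countable and `μ` σ-finite, as the product measure arguments
  -- require. The radius `|r| + 1` also covers `r ≤ 0`.
  have : ProperSpace X := ⟨fun x r => (hballs x (|r| + 1) (by positivity)).of_isClosed_subset
    Metric.isClosed_closedBall ((Metric.closedBall_subset_ball
      (by linarith [le_abs_self r])).trans subset_closure)⟩
  obtain ⟨c₃, c₄, c₅, c₆, -, -, hc₅, hc₆, hbd⟩ := hsub
  -- The exceptional null set depends on `t`; continuity and full support remove it, so the bound
  -- can be integrated in time at fixed `(x,y)`.
  have hlow : ∀ t : ℝ, 0 < t → ∀ x y, c₅ * t ^ (-dH / dW) *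
      Real.exp (-c₆ * (dist x y ^ dW / t) ^ (1 / (dW - 1))) ≤ p t x y := by
    intro t ht x y
    refine le_of_ae_le_of_isOpenPosMeasure (ν := μ.prod μ)
      (u := fun z : X × X => c₅ * t ^ (-dH / dW) *
        Real.exp (-c₆ * (dist z.1 z.2 ^ dW / t) ^ (1 / (dW - 1)))) ?_
      (hp.continuous t ht) ((hbd t ht).mono fun z hz => hz.1) (x, y)
    have h1 : Continuous fun z : X × X => dist z.1 z.2 ^ dW :=
      continuous_dist.rpow_const fun _ => Or.inr (by linarith)
    have h2 : Continuous fun z : X × X => (dist z.1 z.2 ^ dW / t) ^ (1 / (dW - 1)) :=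
      (h1.div_const t).rpow_const fun _ => Or.inr (one_div_nonneg.2 (by linarith))
    fun_prop
  have o : X := hX.some
  have hball : ∀ n : ℕ, ∀ᵐ y ∂μ, y ∈ Metric.ball o n →
      ∀ᵐ x ∂μ, x ∈ Metric.ball o n → f x = f y := by
    intro n
    obtain ⟨c, hc, hk⟩ := exists_linear_le_subordinatedKernel hdH hdW hc₅ hc₆ hlow hδ0 hδ1 hη
      (R := 2 * n) (by positivity)
    refine ae_eq_on_of_setLIntegral_eq_zero (Lp.stronglyMeasurable f).measurable hq0
      measurableSet_ball
      (setLIntegral_eq_zero_of_besovSeminorm_lt_top hq0 hα hf measurableSet_ball hc ?_)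
    filter_upwards [hk] with t ht x hx y hy
    refine ht x y ?_
    have := dist_triangle_right x y o
    rw [Metric.mem_ball] at hx hy
    linarith
  have huniv := hAhlfors.measure_univ_eq_top hdH
  have hμ : μ ≠ 0 := by
    rintro rfl
    simp at huniv
  have : NeZero μ := ⟨hμ⟩
  -- One `y` serves all balls at once, so the constants agree.
  obtain ⟨y, hy⟩ := (ae_all_iff.2 hball).exists
  have hconst : f =ᵐ[μ] fun _ => f y := by
    have h : ∀ᵐ x ∂μ, ∀ n : ℕ, y ∈ Metric.ball o n → x ∈ Metric.ball o n → f x = f y := by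
      refine ae_all_iff.2 fun n => ?_
      by_cases hn : y ∈ Metric.ball o n
      · filter_upwards [hy n hn] with x hx _ using hx
      · exact Eventually.of_forall fun x h => absurd h hn
    filter_upwards [h] with x hx
    obtain ⟨n, hn⟩ := exists_nat_gt (max (dist x o) (dist y o))
    exact hx n ((le_max_right _ _).trans_lt hn) ((le_max_left _ _).trans_lt hn)
  have hmem : MemLp (fun _ : X => f y) (ENNReal.ofReal q) μ := (Lp.memLp f).ae_eq hconst
  rw [memLp_const_iff (by simpa using hq0) ENNReal.ofReal_ne_top] at hmem
  have hy0 : f y = 0 := hmem.resolve_right (by simp [huniv])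
  rw [hy0] at hconst
  exact hconst
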